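/- Let $n\ge 0$, $a\ge 1$, $k\ge 0$ be integers and let $\vec p=(p_1,\dots,p_a)$ be a probability vector, i.e. $p_i\ge 0$ and $p_1+\cdots+p_a=1$. Let $P_{n,a;\vec p}$ be the biased riffle shuffle measure on the symmetric group $S_n$, defined as the law of $\pi$ where $\pi^{-1}$ is produced as follows: starting from the ordered deck $1,\dots,n$, deal the cards independently into $a$ piles, each card going to pile $i$ with probability $p_i$, and then assemble the piles from left to right, keeping the cards within each pile in their original relative order; $\pi^{-1}(m)$ is the card in position $m$ of the resulting deck. Let $P_{n,a;\vec p}^{*k}$ denote the $k$-fold convolution of $P_{n,a;\vec p}$ with itself on $S_n$, where $(P*Q)(\pi)=\sum_{\sigma\in S_n}P(\sigma)\,Q(\sigma^{-1}\pi)$ and $P^{*0}$ is the point mass at the identity. Then the expected number of fixed points of a permutation with law $P_{n,a;\vec p}^{*k}$ is \[ \sum_{\pi\in S_n} P_{n,a;\vec p}^{*k}(\pi)\,\bigl|\{m : \pi(m)=m\}\bigr| \;=\; \sum_{j=1}^{n}\bigl(p_1^j+\cdots+p_a^j\bigr)^k . \] -/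

import Mathlib

/-- The mass function of the biased riffle shuffle of `n` cards with pile probabilities
`p 0, …, p (a - 1)`, given through its inverse. Card `i` is dealt, independently of the other
cards, to pile `w i`, where pile `c` has probability `p c`; the piles are then assembled from left
to right, the cards of each pile keeping their relative order. After this, the card in position `m`
is card `Tuple.sort w m` (`Tuple.sort` is the stable sort: it breaks ties by the index).
The shuffle is the inverse of the resulting permutation. -/
def biasedShuffle (n a : ℕ) (p : Fin a → ℝ) (π : Equiv.Perm (Fin n)) : ℝ :=
  ∑ w : Fin n → Fin a with (Tuple.sort w)⁻¹ = π, ∏ i, p (w i)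

/-- Convolution of two mass functions on the symmetric group. -/
def convolution {n : ℕ} (P Q : Equiv.Perm (Fin n) → ℝ) (π : Equiv.Perm (Fin n)) : ℝ :=
  ∑ σ : Equiv.Perm (Fin n), P σ * Q (σ⁻¹ * π)

/-- The `k`-fold convolution of a mass function on the symmetric group with itself; for `k = 0` it
is the point mass at the identity. -/
def convolutionPower {n : ℕ} (P : Equiv.Perm (Fin n) → ℝ) : ℕ → Equiv.Perm (Fin n) → ℝ
  | 0 => fun π => if π = 1 then 1 else 0
  | k + 1 => convolution (convolutionPower P k) P

/-- The expectation of a random variable on the symmetric group under a mass function. -/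
def expectation {n : ℕ} (P : Equiv.Perm (Fin n) → ℝ) (X : Equiv.Perm (Fin n) → ℝ) : ℝ :=
  ∑ π : Equiv.Perm (Fin n), P π * X π

/-- The number of fixed points of a permutation. -/
def numFixedPoints {n : ℕ} (π : Equiv.Perm (Fin n)) : ℕ :=
  (Finset.univ.filter fun i => π i = i).card

/-! The expected number of fixed points is the trace of the one-card matrix, and convolution becomes
matrix multiplication, so the eigenvalues of one shuffle suffice. If card `i` (counted from 0) is
dealt to pile `c`, each earlier card ends ahead of it with probability `s + p c` and each later one
with probability `s`, where `s` is the total mass of the piles before `c`. Its new position thus has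
generating function `(1 + s X + p c X) ^ i * (1 + s X) ^ (n - 1 - i)` in powers of `1 + X`.
Expanding in `p c * X` shows that the chain is triangular on the functions `i ↦ i.choose m`, with
diagonal entries `∑ c, p c ^ (m + 1)`. -/

/-- The matrix of the one-card chain of a mass function on the symmetric group: its `(i, j)` entry
is the total mass of the permutations that send `i` to `j`. -/
def oneCardMatrix {n : ℕ} (P : Equiv.Perm (Fin n) → ℝ) : Matrix (Fin n) (Fin n) ℝ :=
  fun i j => ∑ π : Equiv.Perm (Fin n), P π * if π i = j then 1 else 0

lemma oneCardMatrix_mul_apply {n : ℕ} (P : Equiv.Perm (Fin n) → ℝ)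
    (A : Matrix (Fin n) (Fin n) ℝ) (i j : Fin n) :
    (oneCardMatrix P * A) i j = ∑ π : Equiv.Perm (Fin n), P π * A (π i) j := by
  simp only [Matrix.mul_apply, oneCardMatrix, Finset.sum_mul]
  rw [Finset.sum_comm]
  refine Finset.sum_congr rfl fun π _ => ?_
  simp

/-- In `σ * τ` the factor `τ`, of law `Q`, acts first; hence the reversed order. -/
lemma oneCardMatrix_convolution {n : ℕ} (P Q : Equiv.Perm (Fin n) → ℝ) :
    oneCardMatrix (convolution P Q) = oneCardMatrix Q * oneCardMatrix P := by
  ext i j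
  rw [oneCardMatrix_mul_apply]
  simp only [oneCardMatrix, convolution, Finset.sum_mul, Finset.mul_sum]
  rw [Finset.sum_comm]
  conv_rhs => rw [Finset.sum_comm]
  refine Finset.sum_congr rfl fun σ _ => ?_
  refine Fintype.sum_equiv (Equiv.mulLeft σ⁻¹) _ _ fun π => ?_
  have h : σ ((σ⁻¹ * π) i) = π i := by simp
  rw [Equiv.coe_mulLeft, h]
  ring

lemma oneCardMatrix_convolutionPower {n : ℕ} (P : Equiv.Perm (Fin n) → ℝ) (k : ℕ) :
    oneCardMatrix (convolutionPower P k) = oneCardMatrix P ^ k := by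
  induction k with
  | zero =>
    ext i j
    rw [oneCardMatrix, Finset.sum_eq_single 1]
    · by_cases h : i = j <;> simp [convolutionPower, h]
    · intro π _ h
      simp [convolutionPower, h]
    · simp
  | succ k ih => rw [convolutionPower, oneCardMatrix_convolution, ih, pow_succ']

lemma expectation_numFixedPoints {n : ℕ} (P : Equiv.Perm (Fin n) → ℝ) :
    expectation P (fun π => (numFixedPoints π : ℝ)) = (oneCardMatrix P).trace := by
  simp only [expectation, numFixedPoints, Matrix.trace, Matrix.diag, oneCardMatrix]
  rw [Finset.sum_comm]
  refine Finset.sum_congr rfl fun π _ => ?_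
  rw [← Finset.mul_sum, Finset.sum_boole]

/-- The powers of an upper triangular matrix are upper triangular, and their diagonal entries are
the powers of its diagonal entries. -/
lemma upperTriangular_pow {n : ℕ} {U : Matrix (Fin n) (Fin n) ℝ} (hU : U.BlockTriangular id)
    (k : ℕ) : (U ^ k).BlockTriangular id ∧ ∀ i, (U ^ k) i i = U i i ^ k := by
  induction k with
  | zero => exact ⟨by simpa using Matrix.blockTriangular_one, by simp⟩
  | succ k ih =>
    rw [pow_succ]
    refine ⟨ih.1.mul hU, fun i => ?_⟩
    rw [Matrix.mul_apply, Finset.sum_eq_single i, ih.2, pow_succ]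
    · intro j _ hj
      rcases lt_or_gt_of_ne hj with h | h
      · rw [ih.1 h, zero_mul]
      · rw [hU h, mul_zero]
    · simp

/-- The Pascal matrix, with `(i, m)` entry `i.choose m`. -/
def pascalMatrix (n : ℕ) : Matrix (Fin n) (Fin n) ℝ := fun i m => ((i : ℕ).choose m : ℝ)

lemma det_pascalMatrix (n : ℕ) : (pascalMatrix n).det = 1 := by
  rw [Matrix.det_of_isLowerTriangular]
  · simp [pascalMatrix]
  · intro i j hij
    have h : (i : ℕ) < j := hij
    simp [pascalMatrix, Nat.choose_eq_zero_of_lt h]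

/-- The Pascal matrix is invertible, so `M` is similar to `U`. -/
lemma trace_pow_of_mul_pascalMatrix {n : ℕ} {M U : Matrix (Fin n) (Fin n) ℝ}
    (hU : U.BlockTriangular id) (h : M * pascalMatrix n = pascalMatrix n * U) (k : ℕ) :
    (M ^ k).trace = ∑ i, U i i ^ k := by
  have hu : IsUnit (pascalMatrix n).det := by simp [det_pascalMatrix]
  have hk : pascalMatrix n * U ^ k = M ^ k * pascalMatrix n :=
    (show SemiconjBy (pascalMatrix n) U M from h.symm).pow_right k
  have hM : M ^ k = pascalMatrix n * U ^ k * (pascalMatrix n)⁻¹ := by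
    rw [hk, Matrix.mul_nonsing_inv_cancel_right _ _ hu]
  rw [hM, Matrix.trace_mul_comm, Matrix.nonsing_inv_mul_cancel_left _ _ hu]
  exact Finset.sum_congr rfl fun i _ => (upperTriangular_pow hU k).2 i

/-- The stable sort moves card `i` behind exactly the cards of the earlier piles and the earlier
cards of its own pile. -/
lemma sort_inv_val {n a : ℕ} (w : Fin n → Fin a) (i : Fin n) :
    (((Tuple.sort w)⁻¹ i : Fin n) : ℕ) =
      (Finset.univ.filter fun l => w l < w i ∨ (w l = w i ∧ l < i)).card := by
  obtain ⟨hmono, hstab⟩ := Tuple.eq_sort_iff.1 (rfl : Tuple.sort w = Tuple.sort w)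
  set σ := Tuple.sort w
  have key : ∀ x y : Fin n, x < y → w (σ x) < w (σ y) ∨ (w (σ x) = w (σ y) ∧ σ x < σ y) := by
    intro x y hxy
    rcases (hmono hxy.le).lt_or_eq with h | h
    · exact Or.inl h
    · exact Or.inr ⟨h, hstab x y hxy h⟩
  have hiff : ∀ l, (w l < w i ∨ (w l = w i ∧ l < i)) ↔ σ⁻¹ l < σ⁻¹ i := by
    intro l
    constructor
    · intro h
      by_contra hn
      rcases (not_lt.1 hn).lt_or_eq with h' | h'
      · have : w i < w l ∨ (w i = w l ∧ i < l) := by simpa using key _ _ h'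
        rcases h with h | ⟨h, h2⟩ <;> rcases this with h3 | ⟨h3, h4⟩
        · exact lt_asymm h h3
        · exact h.ne' h3
        · exact h3.ne' h
        · exact lt_asymm h2 h4
      · have : i = l := σ⁻¹.injective h'
        subst this
        simp at h
    · intro h
      simpa using key _ _ h
  simp only [hiff]
  rw [← Fin.card_Iio (σ⁻¹ i)]
  refine (Finset.card_bij (fun l _ => σ⁻¹ l) ?_ ?_ ?_).symm
  · intro l hl
    simpa using hl
  · intro x _ y _ h
    exact σ⁻¹.injective h
  · intro y hy
    exact ⟨σ y, by simpa using hy, by simp⟩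

lemma prod_ite_lt_ite_eq {n : ℕ} {R : Type*} [CommRing R] (i : Fin n) (x y z : R) :
    (∏ l : Fin n, if l = i then y else if l < i then x else z) =
      y * (x ^ (i : ℕ) * z ^ (n - 1 - (i : ℕ))) := by
  rw [Finset.prod_ite, Finset.prod_ite]
  have h2 : ((Finset.univ.filter fun l : Fin n => ¬ l = i).filter fun l => l < i) =
      Finset.Iio i := by
    ext l
    simp only [Finset.mem_filter, Finset.mem_univ, true_and, Finset.mem_Iio]
    omega
  have h3 : ((Finset.univ.filter fun l : Fin n => ¬ l = i).filter fun l => ¬ l < i) =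
      Finset.Ioi i := by
    ext l
    simp only [Finset.mem_filter, Finset.mem_univ, true_and, Finset.mem_Ioi]
    omega
  rw [h2, h3]
  simp [Finset.filter_eq']

open Polynomial in
/-- The generating polynomial of the binomial moments of the new position of card `i`. -/
lemma sum_prod_mul_one_add_X_pow {n a : ℕ} (p : Fin a → ℝ) (hsum : ∑ i, p i = 1) (i : Fin n) :
    (∑ w : Fin n → Fin a, C (∏ l, p (w l)) *
        (1 + X) ^ (((Tuple.sort w)⁻¹ i : Fin n) : ℕ) : ℝ[X]) =
      ∑ c, C (p c) * ((1 + C (∑ b ∈ Finset.Iio c, p b) * X + C (p c) * X) ^ (i : ℕ) *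
        (1 + C (∑ b ∈ Finset.Iio c, p b) * X) ^ (n - 1 - (i : ℕ))) := by
  -- Weight of dealing card `l` to pile `b` when card `i` is required to be in pile `c`; a factor `1
  -- + X` marks each card that ends ahead of card `i`.
  let h : Fin a → Fin n → Fin a → ℝ[X] := fun c l b =>
    if l = i then (if b = c then C (p b) else 0)
    else C (p b) * if b < c ∨ (b = c ∧ l < i) then 1 + X else 1
  have hw : ∀ w : Fin n → Fin a, C (∏ l, p (w l)) *
      (1 + X) ^ (((Tuple.sort w)⁻¹ i : Fin n) : ℕ) = ∑ c, ∏ l, h c l (w l) := by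
    intro w
    rw [Finset.sum_eq_single (w i)]
    · rw [sort_inv_val, ← Finset.prod_const, Finset.prod_filter, map_prod,
        ← Finset.prod_mul_distrib]
      refine Finset.prod_congr rfl fun l _ => ?_
      by_cases hl : l = i
      · subst hl
        simp [h]
      · simp [h, hl]
    · intro c _ hc
      refine Finset.prod_eq_zero (Finset.mem_univ i) ?_
      simp [h, hc.symm]
    · simp
  have htot : (∑ b, C (p b) : ℝ[X]) = 1 := by rw [← map_sum, hsum, map_one]
  have hfac : ∀ c l, ∑ b, h c l b = if l = i then C (p c) else if l < i then
      1 + C (∑ b ∈ Finset.Iio c, p b) * X + C (p c) * X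
      else 1 + C (∑ b ∈ Finset.Iio c, p b) * X := by
    intro c l
    have hlow : (∑ b, if b < c then C (p b) * X else 0 : ℝ[X]) =
        C (∑ b ∈ Finset.Iio c, p b) * X := by
      rw [map_sum, Finset.sum_mul, ← Finset.sum_filter]
      congr 1
      ext b
      simp
    have heq : (∑ b, if b = c then C (p b) * X else 0 : ℝ[X]) = C (p c) * X := by simp
    by_cases hl : l = i
    · simp [h, hl]
    · by_cases hli : l < i
      · simp only [h, hl, hli, if_true, if_false, and_true]
        conv_rhs => rw [← htot, ← hlow, ← heq, ← Finset.sum_add_distrib, ← Finset.sum_add_distrib]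
        refine Finset.sum_congr rfl fun b _ => ?_
        rcases lt_trichotomy b c with hb | hb | hb
        · simp [hb, hb.ne, mul_add]
        · simp [hb, mul_add]
        · simp [hb.ne', hb.not_gt]
      · simp only [h, hl, hli, if_false, and_false, or_false]
        conv_rhs => rw [← htot, ← hlow, ← Finset.sum_add_distrib]
        refine Finset.sum_congr rfl fun b _ => ?_
        by_cases hb : b < c
        · simp [hb, mul_add]
        · simp [hb]
  simp only [hw]
  rw [Finset.sum_comm]
  refine Finset.sum_congr rfl fun c _ => ?_
  -- Independence of the cards: the sum over all deals factors card by card.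
  rw [← Fintype.piFinset_univ, ← Finset.prod_univ_sum]
  simp only [hfac]
  rw [prod_ite_lt_ite_eq]

open Polynomial in
/-- The matrix of the one-card chain of the biased shuffle in the basis of binomial
coefficients. -/
noncomputable def binomialMomentMatrix (n a : ℕ) (p : Fin a → ℝ) : Matrix (Fin n) (Fin n) ℝ :=
  fun l m => ∑ c, p c ^ ((l : ℕ) + 1) *
    (X ^ (l : ℕ) * (1 + C (∑ b ∈ Finset.Iio c, p b) * X) ^ (n - 1 - (l : ℕ)) : ℝ[X]).coeff m

lemma binomialMomentMatrix_blockTriangular (n a : ℕ) (p : Fin a → ℝ) :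
    (binomialMomentMatrix n a p).BlockTriangular id := by
  intro l m hml
  have h : ¬ (l : ℕ) ≤ m := not_le.2 hml
  simp [binomialMomentMatrix, Polynomial.coeff_X_pow_mul', h]

lemma binomialMomentMatrix_diag (n a : ℕ) (p : Fin a → ℝ) (l : Fin n) :
    binomialMomentMatrix n a p l l = ∑ c, p c ^ ((l : ℕ) + 1) := by
  simp [binomialMomentMatrix, Polynomial.coeff_X_pow_mul', Polynomial.coeff_zero_eq_eval_zero]

lemma sum_biasedShuffle_mul (n a : ℕ) (p : Fin a → ℝ) (f : Equiv.Perm (Fin n) → ℝ) :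
    ∑ π, biasedShuffle n a p π * f π =
      ∑ w : Fin n → Fin a, (∏ l, p (w l)) * f (Tuple.sort w)⁻¹ := by
  simp only [biasedShuffle, Finset.sum_mul, Finset.sum_filter]
  rw [Finset.sum_comm]
  refine Finset.sum_congr rfl fun w _ => ?_
  simp [ite_mul]

open Polynomial in
lemma oneCardMatrix_biasedShuffle_mul_pascalMatrix (n a : ℕ) (p : Fin a → ℝ)
    (hsum : ∑ i, p i = 1) :
    oneCardMatrix (biasedShuffle n a p) * pascalMatrix n =
      pascalMatrix n * binomialMomentMatrix n a p := by
  ext i m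
  rw [oneCardMatrix_mul_apply, sum_biasedShuffle_mul n a p fun π => pascalMatrix n (π i) m]
  -- The coefficient of `X ^ m` in `(1 + X) ^ s` is the Pascal entry `s.choose m`.
  have hgen := congrArg (fun q : ℝ[X] => q.coeff m) (sum_prod_mul_one_add_X_pow p hsum i)
  simp only [finsetSum_coeff, coeff_C_mul, coeff_one_add_X_pow] at hgen
  simp only [pascalMatrix]
  rw [hgen, Matrix.mul_apply]
  simp only [binomialMomentMatrix, Finset.mul_sum]
  rw [Finset.sum_comm]
  refine Finset.sum_congr rfl fun c _ => ?_
  set Q : ℝ[X] := 1 + C (∑ b ∈ Finset.Iio c, p b) * X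
  -- The exponents of `Q` add up to `n - 1 - l`, so `i` survives only in `i.choose l`.
  have hexp : (Q + C (p c) * X) ^ (i : ℕ) * Q ^ (n - 1 - (i : ℕ)) =
      ∑ l : Fin n, C (((i : ℕ).choose l : ℝ) * p c ^ (l : ℕ)) *
        (X ^ (l : ℕ) * Q ^ (n - 1 - (l : ℕ))) := by
    rw [Fin.sum_univ_eq_sum_range (fun l => C (((i : ℕ).choose l : ℝ) * p c ^ l) *
      (X ^ l * Q ^ (n - 1 - l))) n, add_comm Q, add_pow, Finset.sum_mul]
    -- The terms with `i < l < n` vanish.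
    rw [← Finset.sum_subset (Finset.range_subset_range.2 (Nat.succ_le_of_lt i.2))]
    · refine Finset.sum_congr rfl fun l hl => ?_
      have hl' : l ≤ i := Nat.lt_succ_iff.1 (Finset.mem_range.1 hl)
      have hi := i.2
      have he : n - 1 - l = (i - l) + (n - 1 - i) := by omega
      rw [he, pow_add]
      simp only [map_mul, map_pow, map_natCast, mul_pow]
      ring
    · intro l _ hl
      have hl' : (i : ℕ) < l := by simpa [Nat.lt_succ_iff] using hl
      simp [Nat.choose_eq_zero_of_lt hl']
  rw [hexp, finsetSum_coeff, Finset.mul_sum]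
  refine Finset.sum_congr rfl fun l _ => ?_
  rw [coeff_C_mul, pascalMatrix]
  ring

theorem corollary6 (n a k : ℕ) (p : Fin a → ℝ) (hp : ∀ i, 0 ≤ p i) (hsum : ∑ i, p i = 1) :
    expectation (convolutionPower (biasedShuffle n a p) k) (fun π => (numFixedPoints π : ℝ)) =
      ∑ j ∈ Finset.Icc 1 n, (∑ i, p i ^ j) ^ k := by
  rw [expectation_numFixedPoints, oneCardMatrix_convolutionPower,
    trace_pow_of_mul_pascalMatrix (binomialMomentMatrix_blockTriangular n a p)
      (oneCardMatrix_biasedShuffle_mul_pascalMatrix n a p hsum)]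
  simp only [binomialMomentMatrix_diag]
  rw [Fin.sum_univ_eq_sum_range (fun l => (∑ c, p c ^ (l + 1)) ^ k) n, Finset.range_eq_Ico,
    Finset.sum_Ico_add' (fun j => (∑ c, p c ^ j) ^ k) 0 n 1]
  rfl
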